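/- Let $k \ge 0$ be an integer and let $M = (m_{ij})$ be a real symmetric positive definite $k \times k$ matrix with $m_{ii} = 1$ for all $i$ and $m_{ij} \ge 0$ for all $i, j$. Let $X = (X_1, \dots, X_k)$ be a Gaussian vector in $\mathbb{R}^k$ with mean zero and covariance matrix $M$, let $\Phi$ and $\phi$ denote the standard Gaussian distribution function and density on $\mathbb{R}$, and define \[ J(x; M) = \Pr\left(X_i \le \Phi^{-1}(x_i) \text{ for all } i\right), \qquad x = (x_1, \dots, x_k) \in [0,1]^k, \] where $\Phi^{-1}(0) = -\infty$ and $\Phi^{-1}(1) = \infty$. Then $J(\cdot\,; M)$ is twice continuously differentiable on $(0,1)^k$, and for every $x \in (0,1)^k$ its Hessian matrix $H_J(x) = (\partial_i \partial_j J(x; M))_{i,j}$ satisfies \[ M \odot H_J(x) \le 0, \] i.e. the entrywise (Hadamard) product $M \odot H_J(x)$ is a symmetric negative semidefinite matrix. Moreover, with $I(p) = \phi(\Phi^{-1}(p))$ and $\mathcal{I}(x) = \mathrm{diag}\left(1/I(x_1), \dots, 1/I(x_k)\right)$, one has $M \odot H_J(x) = \mathcal{I}(x)\, A(x)\, \mathcal{I}(x)$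 for some $k \times k$ matrix $A(x)$ all of whose off-diagonal entries are nonnegative and all of whose row sums are zero. -/

import Mathlib

open MeasureTheory ProbabilityTheory Matrix

noncomputable section

/-- The inverse `Φ⁻¹` of the standard Gaussian distribution function
`Φ(y) = γ₁((-∞, y])`, with values in `[-∞, ∞]`: on `(0, 1)` it is the ordinary (finite)
inverse of the strictly increasing continuous function `Φ`, and
`Φ⁻¹(0) = -∞`, `Φ⁻¹(1) = ∞`. -/
def gaussianQuantile (p : ℝ) : EReal :=
  sInf ((fun y : ℝ => (y : EReal)) '' {y : ℝ | p ≤ cdf (gaussianReal 0 1) y})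

/-- The Gaussian orthant function
`J(x; M) = P(X_i ≤ Φ⁻¹(x_i) for all i)`, where `X` is a centred Gaussian vector in `ℝᵏ`
with covariance matrix `M`. -/
def gaussianOrthant {k : ℕ} (M : Matrix (Fin k) (Fin k) ℝ) (x : Fin k → ℝ) : ℝ :=
  (multivariateGaussian (0 : EuclideanSpace ℝ (Fin k)) M).real
    {y | ∀ i, ((y i : ℝ) : EReal) ≤ gaussianQuantile (x i)}

/-- The Gaussian isoperimetric profile `I(p) = φ(Φ⁻¹(p))` for `p ∈ (0, 1)`, where `φ` is the
standard Gaussian density. -/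
def gaussianProfile (p : ℝ) : ℝ :=
  gaussianPDFReal 0 1 (gaussianQuantile p).toReal

/-- The `i`-th partial derivative of a function of `k` real variables. -/
def partialDeriv {k : ℕ} (i : Fin k) (f : (Fin k → ℝ) → ℝ) (x : Fin k → ℝ) : ℝ :=
  lineDeriv ℝ f x (Pi.single i 1)

/-- The Hessian matrix `(∂_i ∂_j f)(x)`. -/
def hessianMatrix {k : ℕ} (f : (Fin k → ℝ) → ℝ) (x : Fin k → ℝ) :
    Matrix (Fin k) (Fin k) ℝ :=
  Matrix.of fun i j => partialDeriv i (partialDeriv j f) x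

end

/-! Write `X_i = ⟪v_i, z⟫` with `z` standard Gaussian and `v_i` the rows of `√M`. The residuals of
the regression on `X_j` are orthogonal to `v_j`, hence independent of `X_j`. So the partial
derivative in the threshold `b_j` of an orthant probability is a Gaussian density times an orthant
probability of the residuals (`orthantProb_eq_integral`). Residuals stay linearly independent, so
this iterates and gives smoothness (`contDiff_orthantProb`).

With `b_i = Φ⁻¹(x_i)` and `‖v_j‖ = 1`, the chain-rule factor `1 / I(x_j)` cancels the density: `∂_j
J` is the probability that the residuals lie below `b_l - m_{jl} b_j`. Let `B_l ≥ 0` be its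
derivative in the `l`-th residual threshold. Then `∂_i ∂_j J = B_i / I(x_i)` for `i ≠ j`, and `∂_j²
J = -(∑ l, m_{jl} B_l) / I(x_j)` (`hessianMatrix_gaussianOrthant`).

Hence `A_{ij} = I(x_i) m_{ij} (∂_i ∂_j J) I(x_j)` is symmetric, nonnegative off the diagonal, and
has zero row sums. It is minus a weighted graph Laplacian, so negative semidefinite, and `M ⊙ H` is
congruent to it. -/

/-! ### Regularity from continuous partial derivatives -/

section PartialDerivatives

open Filter Topology Asymptotics

variable {ι : Type*} [Fintype ι] [DecidableEq ι]

/-- A function on `ℝ^ι` all of whose partial derivatives exist and are continuous is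
(Fréchet) differentiable. -/
theorem hasFDerivAt_of_continuous_partials {f : (ι → ℝ) → ℝ} {D : ι → (ι → ℝ) → ℝ}
    (hD : ∀ i, Continuous (D i))
    (hf : ∀ i b t, HasDerivAt (fun t => f (Function.update b i t)) (D i (Function.update b i t)) t)
    (x : ι → ℝ) :
    HasFDerivAt f (∑ i, D i x • (ContinuousLinearMap.proj i : (ι → ℝ) →L[ℝ] ℝ)) x := by
  -- Move from `x` to `y` one coordinate at a time; `s` is the set of coordinates already moved.
  have key : ∀ s : Finset ι, (fun y : ι → ℝ =>
      f (s.piecewise y x) - f x - ∑ i ∈ s, D i x * (y i - x i)) =o[𝓝 x] fun y => y - x := by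
    intro s
    induction s using Finset.induction_on with
    | empty => simp
    | insert i s his ih =>
      have step : (fun y : ι → ℝ => f ((insert i s).piecewise y x) - f (s.piecewise y x)
          - D i x * (y i - x i)) =o[𝓝 x] fun y => y - x := by
        rw [isLittleO_iff]
        intro ε hε
        obtain ⟨δ, hδ, hball⟩ := Metric.continuousAt_iff.1 (hD i).continuousAt ε hε
        filter_upwards [Metric.ball_mem_nhds x hδ] with y hy
        rw [Metric.mem_ball, dist_pi_lt_iff hδ] at hy
        set c := s.piecewise y x with hc
        have hci : c i = x i := by simp [hc, his]
        have hcx : ∀ t ∈ Metric.ball (x i) δ, dist (Function.update c i t) x < δ := by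
          intro t ht
          rw [dist_pi_lt_iff hδ]
          intro j
          by_cases hj : j = i
          · subst hj; simpa using ht
          · rw [Function.update_of_ne hj]
            by_cases hjs : j ∈ s
            · simpa [hc, hjs] using hy j
            · simpa [hc, hjs] using hδ
        have hder : ∀ t ∈ Metric.ball (x i) δ,
            HasDerivWithinAt (fun t => f (Function.update c i t) - D i x * t)
              (D i (Function.update c i t) - D i x) (Metric.ball (x i) δ) t := by
          intro t _
          simpa using ((hf i c t).fun_sub ((hasDerivAt_id' t).const_mul (D i x))).hasDerivWithinAt
        have := Convex.norm_image_sub_le_of_norm_hasDerivWithin_le hder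
          (C := ε) (fun t ht => by
            rw [← dist_eq_norm]; exact (hball (hcx t ht)).le) (convex_ball _ _)
          (Metric.mem_ball_self hδ) (hy i)
        rw [Finset.piecewise_insert]
        have hcu : Function.update c i (x i) = c := by rw [← hci, Function.update_eq_self]
        rw [hcu] at this
        calc _ = ‖f (Function.update c i (y i)) - D i x * y i - (f c - D i x * x i)‖ := by
              congr 1; ring
          _ ≤ ε * ‖y i - x i‖ := this
          _ ≤ ε * ‖y - x‖ := by
              gcongr
              simpa using norm_le_pi_norm (y - x) i
      refine (ih.add step).congr_left fun y => ?_
      rw [Finset.sum_insert his]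
      ring
  rw [hasFDerivAt_iff_isLittleO]
  refine (key Finset.univ).congr_left fun y => ?_
  simp

/-- If the partial derivatives of a function on `ℝ^ι` exist and are `Cⁿ`, then the function is
`Cⁿ⁺¹`. -/
theorem contDiff_succ_of_partials {n : ℕ} {f : (ι → ℝ) → ℝ} {D : ι → (ι → ℝ) → ℝ}
    (hD : ∀ i, ContDiff ℝ n (D i))
    (hf : ∀ i b t, HasDerivAt (fun t => f (Function.update b i t)) (D i (Function.update b i t)) t) :
    ContDiff ℝ (n + 1) f :=
  contDiff_succ_iff_hasFDerivAt.2
    ⟨_, ContDiff.sum fun i _ => (hD i).smul contDiff_const,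
      hasFDerivAt_of_continuous_partials (fun i => (hD i).continuous) hf⟩

end PartialDerivatives

/-! ### Gaussian orthant probabilities and their derivatives -/

section OrthantProb

open Filter Topology RealInnerProductSpace

variable {E : Type*} [NormedAddCommGroup E] [InnerProductSpace ℝ E] {ι : Type*}

/-- The coefficient of the regression of `⟪v j, z⟫` on `⟪v i, z⟫`. -/
noncomputable def regressionCoeff (v : ι → E) (i j : ι) : ℝ := ⟪v i, v j⟫ / ‖v i‖ ^ 2

/-- The residuals of the regression on `⟪v i, z⟫`. -/
noncomputable def regressionResidual (v : ι → E) (i j : ι) : E := v j - regressionCoeff v i j • v i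

theorem inner_residual {v : ι → E} {i : ι} (hi : v i ≠ 0) (j : ι) : ⟪v i, regressionResidual v i j⟫ = 0 := by
  have : ‖v i‖ ≠ 0 := by simpa
  rw [regressionResidual, inner_sub_right, inner_smul_right, regressionCoeff, real_inner_self_eq_norm_sq]
  field_simp
  simp

theorem linearIndepOn_residual [DecidableEq ι] {v : ι → E} {s : Finset ι} (hv : LinearIndepOn ℝ v (s : Set ι)) {i : ι}
    (hi : i ∈ s) : LinearIndepOn ℝ (regressionResidual v i) (s.erase i : Set ι) := by
  rw [linearIndepOn_finset_iff] at hv ⊢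
  intro f hf j hj
  have hji := Finset.ne_of_mem_erase hj
  -- A relation among the residuals is a relation among the `v l`, with this coefficient collected
  -- at `v i`.
  have h := hv (Function.update f i (-∑ l ∈ s.erase i, f l * regressionCoeff v i l)) ?_ j
    (Finset.mem_of_mem_erase hj)
  · rwa [Function.update_of_ne hji] at h
  · have hcongr : ∑ l ∈ s.erase i, Function.update f i
        (-∑ l ∈ s.erase i, f l * regressionCoeff v i l) l • v l = ∑ l ∈ s.erase i, f l • v l :=
      Finset.sum_congr rfl fun l hl => by rw [Function.update_of_ne (Finset.ne_of_mem_erase hl)]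
    rw [← Finset.add_sum_erase s _ hi, hcongr, Function.update_self]
    refine Eq.trans ?_ hf
    simp only [regressionResidual, smul_sub, Finset.sum_sub_distrib, smul_smul, neg_smul, Finset.sum_smul]
    abel

theorem toNNReal_norm_sq_ne_zero {F : Type*} [NormedAddCommGroup F] {v : F} (hv : v ≠ 0) : (‖v‖ ^ 2).toNNReal ≠ 0 := by
  have : 0 < ‖v‖ ^ 2 := by positivity
  exact (Real.toNNReal_pos.2 this).ne'

variable [FiniteDimensional ℝ E] [MeasurableSpace E]

/-- The probability that a standard Gaussian vector `z` satisfies `⟪v i, z⟫ ≤ b i` for all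
`i ∈ s`. -/
noncomputable def orthantProb (v : ι → E) (s : Finset ι) (b : ι → ℝ) : ℝ :=
  (stdGaussian E).real {z | ∀ i ∈ s, ⟪v i, z⟫ ≤ b i}

theorem orthantProb_congr {v : ι → E} {s : Finset ι} {b c : ι → ℝ} (h : ∀ i ∈ s, b i = c i) :
    orthantProb v s b = orthantProb v s c := by
  unfold orthantProb
  congr 1
  ext z
  exact forall₂_congr fun i hi => by rw [h i hi]

/-- The partial derivatives of a Gaussian orthant probability. -/
noncomputable def orthantProbPartial [DecidableEq ι] (v : ι → E) (s : Finset ι) (i : ι) (b : ι → ℝ) : ℝ :=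
  if i ∈ s then gaussianPDFReal 0 (‖v i‖ ^ 2).toNNReal (b i) *
    orthantProb (regressionResidual v i) (s.erase i) (fun j => b j - regressionCoeff v i j * b i)
  else 0

theorem orthantProbPartial_nonneg [DecidableEq ι] (v : ι → E) (s : Finset ι) (i : ι) (b : ι → ℝ) :
    0 ≤ orthantProbPartial v s i b := by
  unfold orthantProbPartial
  split_ifs
  · exact mul_nonneg (gaussianPDFReal_nonneg _ _ _) measureReal_nonneg
  · exact le_rfl

variable [BorelSpace E]

theorem stdGaussian_map_inner (v : E) :
    (stdGaussian E).map (fun z => ⟪v, z⟫) = gaussianReal 0 (‖v‖ ^ 2).toNNReal := by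
  have := IsGaussian.map_eq_gaussianReal (μ := stdGaussian E) (innerSL ℝ v)
  rw [integral_strongDual_stdGaussian, variance_dual_stdGaussian, innerSL_apply_norm] at this
  exact this

theorem ae_inner_ne {v : E} (hv : v ≠ 0) (c : ℝ) : ∀ᵐ z ∂(stdGaussian E), ⟪v, z⟫ ≠ c := by
  have := nullSingletonClass_gaussianReal (μ := 0) (toNNReal_norm_sq_ne_zero hv)
  have h : ∀ᵐ t ∂((stdGaussian E).map fun z => ⟪v, z⟫), t ≠ c := by
    rw [stdGaussian_map_inner, ae_iff]
    simp
  exact ae_of_ae_map (f := fun z => ⟪v, z⟫) (by fun_prop) h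

theorem measurableSet_orthant (v : ι → E) (s : Finset ι) (b : ι → ℝ) :
    MeasurableSet {z | ∀ i ∈ s, ⟪v i, z⟫ ≤ b i} := by
  have : {z : E | ∀ i ∈ s, ⟪v i, z⟫ ≤ b i} = ⋂ i ∈ s, {z | ⟪v i, z⟫ ≤ b i} := by ext; simp
  rw [this]
  exact s.measurableSet_biInter fun i _ => measurableSet_le (by fun_prop) (by fun_prop)

/-- Off the null hyperplanes `⟪v i, z⟫ = b i`, the indicator of the orthant is locally constant in
the thresholds, so dominated convergence applies. -/
theorem continuous_orthantProb [Finite ι] {v : ι → E} {s : Finset ι} (hv : ∀ i ∈ s, v i ≠ 0) :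
    Continuous (orthantProb v s) := by
  have h : orthantProb v s = fun b => ∫ z, {z | ∀ i ∈ s, ⟪v i, z⟫ ≤ b i}.indicator 1 z
      ∂(stdGaussian E) := by
    ext b
    rw [integral_indicator_one (measurableSet_orthant v s b), orthantProb]
  rw [h, continuous_iff_continuousAt]
  intro b
  refine tendsto_integral_filter_of_dominated_convergence (fun _ => 1) ?_ ?_
    (integrable_const 1) ?_
  · exact .of_forall fun c => (measurable_one.indicator
      (measurableSet_orthant v s c)).aestronglyMeasurable
  · refine .of_forall fun c => .of_forall fun z => ?_
    exact (norm_indicator_le_norm_self _ _).trans (by rw [Pi.one_apply, norm_one])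
  · have : ∀ᵐ z ∂(stdGaussian E), ∀ i ∈ s, ⟪v i, z⟫ ≠ b i :=
      (Finset.eventually_all s).2 fun i hi => ae_inner_ne (hv i hi) _
    filter_upwards [this] with z hz
    refine tendsto_const_nhds.congr' ?_
    have h2 : ∀ᶠ c in 𝓝 b, ∀ i ∈ s, (⟪v i, z⟫ ≤ b i ↔ ⟪v i, z⟫ ≤ c i) := by
      refine (Finset.eventually_all s).2 fun i hi => ?_
      have hcont : Tendsto (fun c : ι → ℝ => c i) (𝓝 b) (𝓝 (b i)) :=
        (continuous_apply i).continuousAt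
      rcases lt_or_gt_of_ne (hz i hi) with hlt | hlt
      · filter_upwards [hcont.eventually (lt_mem_nhds hlt)] with c hc
        exact iff_of_true hlt.le hc.le
      · filter_upwards [hcont.eventually (gt_mem_nhds hlt)] with c hc
        exact iff_of_false (not_le.2 hlt) (not_le.2 hc)
    filter_upwards [h2] with c hc
    have : (∀ i ∈ s, ⟪v i, z⟫ ≤ b i) ↔ ∀ i ∈ s, ⟪v i, z⟫ ≤ c i :=
      forall₂_congr hc
    by_cases hb : ∀ i ∈ s, ⟪v i, z⟫ ≤ b i
    · exact (Set.indicator_of_mem (s := {z | ∀ i ∈ s, ⟪v i, z⟫ ≤ b i}) hb _).trans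
        (Set.indicator_of_mem (s := {z | ∀ i ∈ s, ⟪v i, z⟫ ≤ c i}) (this.1 hb) _).symm
    · exact (Set.indicator_of_notMem (s := {z | ∀ i ∈ s, ⟪v i, z⟫ ≤ b i}) hb _).trans
        (Set.indicator_of_notMem (s := {z | ∀ i ∈ s, ⟪v i, z⟫ ≤ c i}) (mt this.2 hb) _).symm

/-- Jointly Gaussian and uncorrelated implies independent. -/
theorem indepFun_inner [Finite ι] {u : E} {w : ι → E} (h : ∀ j, ⟪u, w j⟫ = 0) :
    IndepFun (fun z => ⟪u, z⟫) (fun z j => ⟪w j, z⟫) (stdGaussian E) := by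
  have hG : HasGaussianLaw (fun z : E => ((fun _ : Unit => ⟪u, z⟫), fun j => ⟪w j, z⟫))
      (stdGaussian E) := by
    let L : E →L[ℝ] (Unit → ℝ) × (ι → ℝ) :=
      (ContinuousLinearMap.pi fun _ => innerSL ℝ u).prod
        (ContinuousLinearMap.pi fun j => innerSL ℝ (w j))
    have hL := isGaussian_map_of_measurable (μ := stdGaussian E) (L := L) (by fun_prop)
    exact ⟨hL⟩
  have hI := hG.indepFun_of_covariance_eval (X := fun _ z => ⟪u, z⟫) (Y := fun j z => ⟪w j, z⟫)
    fun _ j => by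
      rw [← covarianceBilin_apply_eq_cov IsGaussian.memLp_two_id, covarianceBilin_stdGaussian,
        innerSL_apply_apply]
      exact h j
  exact hI.comp (φ := fun f : Unit → ℝ => f ()) (ψ := id) (by fun_prop) (by fun_prop)

/-- Conditioning a Gaussian orthant probability on one of the coordinates. -/
theorem orthantProb_eq_integral [Finite ι] [DecidableEq ι] {v : ι → E} {s : Finset ι} {i : ι}
    (hi : i ∈ s) (hv : v i ≠ 0) (b : ι → ℝ) :
    orthantProb v s b = ∫ t in Set.Iic (b i),
      orthantProb (regressionResidual v i) (s.erase i) (fun j => b j - regressionCoeff v i j * t)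
        ∂(gaussianReal 0 (‖v i‖ ^ 2).toNNReal) := by
  set w := regressionResidual v i with hw
  set r := regressionCoeff v i with hr
  have hind := indepFun_inner (inner_residual hv)
  have hprod := (indepFun_iff_map_prod_eq_prod_map_map (by fun_prop)
    (by fun_prop)).1 hind
  rw [← hw, stdGaussian_map_inner] at hprod
  set γ := gaussianReal 0 (‖v i‖ ^ 2).toNNReal with hγ
  set S : Set (ℝ × (ι → ℝ)) := {p | p.1 ≤ b i ∧ ∀ j ∈ s.erase i, p.2 j ≤ b j - r j * p.1} with hS
  have hSm : MeasurableSet S := by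
    have : S = {p | p.1 ≤ b i} ∩ ⋂ j ∈ s.erase i, {p | p.2 j ≤ b j - r j * p.1} := by
      ext; simp [hS]
    rw [this]
    exact (measurableSet_le (by fun_prop) (by fun_prop)).inter
      ((s.erase i).measurableSet_biInter fun j _ => measurableSet_le (by fun_prop) (by fun_prop))
  have hpre : {z | ∀ j ∈ s, ⟪v j, z⟫ ≤ b j}
      = (fun z : E => (⟪v i, z⟫, fun j => ⟪w j, z⟫)) ⁻¹' S := by
    have hwz : ∀ j z, ⟪w j, z⟫ = ⟪v j, z⟫ - r j * ⟪v i, z⟫ := fun j z => by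
      rw [hw, regressionResidual, inner_sub_left, real_inner_smul_left]
    ext z
    simp only [Set.mem_ofPred_eq, Set.mem_preimage, hS, hwz, Finset.mem_erase, sub_le_sub_iff_right]
    refine ⟨fun h => ⟨h i hi, fun j hj => h j hj.2⟩, fun h j hj => ?_⟩
    by_cases hji : j = i
    · exact hji ▸ h.1
    · exact h.2 j ⟨hji, hj⟩
  have := Measure.isProbabilityMeasure_map (μ := stdGaussian E) (f := fun z j => ⟪w j, z⟫)
    (by fun_prop)
  rw [orthantProb, hpre, ← map_measureReal_apply (by fun_prop) hSm, hprod, measureReal_def,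
    Measure.prod_apply hSm, ← integral_toReal (measurable_measure_prodMk_left hSm).aemeasurable
      (.of_forall fun _ => measure_lt_top _ _), ← integral_indicator measurableSet_Iic]
  refine integral_congr_ae (.of_forall fun t => ?_)
  by_cases ht : t ≤ b i
  · rw [Set.indicator_of_mem (by simpa using ht), orthantProb, measureReal_def]
    beta_reduce
    rw [Measure.map_apply (by fun_prop) (measurable_prodMk_left hSm)]
    simp [hS, ht]
  · rw [Set.indicator_of_notMem (by simpa using ht)]
    simp [hS, ht]

/-- The derivative of a Gaussian distribution function, as a function of one variable. -/
theorem hasDerivAt_integral_Iic_gaussianReal {v : NNReal} (hv : v ≠ 0) {h : ℝ → ℝ}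
    (hc : Continuous h) (hb : ∀ t, ‖h t‖ ≤ 1) (x : ℝ) :
    HasDerivAt (fun y => ∫ t in Set.Iic y, h t ∂(gaussianReal 0 v))
      (gaussianPDFReal 0 v x * h x) x := by
  have hpc : Continuous (gaussianPDFReal 0 v) := by
    unfold gaussianPDFReal; fun_prop
  have heq : ∀ y, ∫ t in Set.Iic y, h t ∂(gaussianReal 0 v)
      = ∫ t in Set.Iic y, gaussianPDFReal 0 v t * h t := by
    intro y
    rw [← integral_indicator measurableSet_Iic, integral_gaussianReal_eq_integral_smul hv,
      ← integral_indicator measurableSet_Iic]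
    refine integral_congr_ae (.of_forall fun t => ?_)
    by_cases ht : t ∈ Set.Iic y <;> simp [ht]
  have hint : Integrable fun t => gaussianPDFReal 0 v t * h t :=
    (integrable_gaussianPDFReal 0 v).mul_bdd hc.aestronglyMeasurable (.of_forall hb)
  simp_rw [heq]
  -- Split the integral over `Iic y` at the fixed point `x` and apply the fundamental theorem of
  -- calculus to the part from `x` to `y`.
  have hd := (intervalIntegral.integral_hasDerivAt_right (hint.intervalIntegrable (a := x) (b := x))
    (hpc.mul hc).aestronglyMeasurable.stronglyMeasurableAtFilter
    (hpc.mul hc).continuousAt).const_add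
      (∫ t in Set.Iic x, gaussianPDFReal 0 v t * h t)
  refine hd.congr_of_eventuallyEq (.of_forall fun y => ?_)
  have := intervalIntegral.integral_Iic_sub_Iic (hint.integrableOn (s := Set.Iic x))
    (hint.integrableOn (s := Set.Iic y))
  simp only [← this]
  ring

variable [Fintype ι] [DecidableEq ι]

theorem hasDerivAt_orthantProb_update {v : ι → E} {s : Finset ι}
    (hv : LinearIndepOn ℝ v (s : Set ι)) (i : ι) (b : ι → ℝ) (t : ℝ) :
    HasDerivAt (fun t => orthantProb v s (Function.update b i t))
      (orthantProbPartial v s i (Function.update b i t)) t := by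
  by_cases hi : i ∈ s
  · have hvi : v i ≠ 0 := hv.ne_zero hi
    have hw := linearIndepOn_residual hv hi
    set h : ℝ → ℝ := fun t => orthantProb (regressionResidual v i) (s.erase i)
      (fun j => b j - regressionCoeff v i j * t) with hh
    have hcongr : ∀ u t, orthantProb (regressionResidual v i) (s.erase i)
        (fun j => Function.update b i u j - regressionCoeff v i j * t) = h t := by
      intro u t
      refine orthantProb_congr fun j hj => ?_
      rw [Function.update_of_ne (Finset.ne_of_mem_erase hj)]
    have hc : Continuous h := (continuous_orthantProb fun j hj => hw.ne_zero hj).comp (by fun_prop)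
    have hb : ∀ t, ‖h t‖ ≤ 1 := fun t => by
      rw [hh]
      beta_reduce
      rw [orthantProb, Real.norm_of_nonneg measureReal_nonneg]
      exact measureReal_le_one
    have := hasDerivAt_integral_Iic_gaussianReal (toNNReal_norm_sq_ne_zero hvi) hc hb t
    simpa [orthantProb_eq_integral hi hvi, orthantProbPartial, hi, hcongr] using this
  · have : ∀ u, orthantProb v s (Function.update b i u) = orthantProb v s b := fun u =>
      orthantProb_congr fun j hj => Function.update_of_ne (ne_of_mem_of_not_mem hj hi) ..
    simp only [this, orthantProbPartial, hi, if_false]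
    exact hasDerivAt_const _ _

/-- Each partial derivative is zero or a smooth density times another orthant probability with
linearly independent vectors, so the induction runs over all `v` and `s` at once. -/
theorem contDiff_orthantProb (n : ℕ) {v : ι → E} {s : Finset ι}
    (hv : LinearIndepOn ℝ v (s : Set ι)) : ContDiff ℝ n (orthantProb v s) := by
  induction n generalizing v s with
  | zero => exact contDiff_zero.2 (continuous_orthantProb fun j hj => hv.ne_zero hj)
  | succ n ih =>
    refine contDiff_succ_of_partials (fun i => ?_) (hasDerivAt_orthantProb_update hv)
    unfold orthantProbPartial
    split_ifs with hi
    · refine ContDiff.mul ?_ ((ih (linearIndepOn_residual hv hi)).comp (by fun_prop))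
      unfold gaussianPDFReal
      fun_prop
    · exact contDiff_const

theorem hasFDerivAt_orthantProb {v : ι → E} {s : Finset ι}
    (hv : LinearIndepOn ℝ v (s : Set ι)) (b : ι → ℝ) :
    HasFDerivAt (orthantProb v s)
      (∑ i, orthantProbPartial v s i b • (ContinuousLinearMap.proj i : (ι → ℝ) →L[ℝ] ℝ)) b := by
  refine hasFDerivAt_of_continuous_partials (fun i => ?_) (hasDerivAt_orthantProb_update hv) b
  unfold orthantProbPartial
  split_ifs with hi
  · refine Continuous.mul ?_ (((contDiff_orthantProb 0 (linearIndepOn_residual hv hi)).continuous).comp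
      (by fun_prop))
    unfold gaussianPDFReal
    fun_prop
  · exact continuous_const

theorem fderiv_orthantProb_single {v : ι → E} {s : Finset ι}
    (hv : LinearIndepOn ℝ v (s : Set ι)) (b : ι → ℝ) (i : ι) :
    fderiv ℝ (orthantProb v s) b (Pi.single i 1) = orthantProbPartial v s i b := by
  rw [(hasFDerivAt_orthantProb hv b).fderiv]
  simp [Pi.single_apply]

end OrthantProb

/-! ### The Gaussian quantile function -/

section Quantile

open Filter Topology

theorem hasDerivAt_cdf_gaussianReal (x : ℝ) :
    HasDerivAt (cdf (gaussianReal 0 1)) (gaussianPDFReal 0 1 x) x := by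
  have h := hasDerivAt_integral_Iic_gaussianReal one_ne_zero (h := fun _ => 1)
    continuous_const (by simp) x
  have heq : (cdf (gaussianReal 0 1) : ℝ → ℝ)
      = fun y => ∫ _ in Set.Iic y, (1 : ℝ) ∂(gaussianReal 0 1) := by
    ext y
    simp [cdf_eq_real]
  rw [heq]
  simpa using h

theorem strictMono_cdf_gaussianReal : StrictMono (cdf (gaussianReal 0 1)) :=
  strictMono_of_hasDerivAt_pos hasDerivAt_cdf_gaussianReal
    fun x => gaussianPDFReal_pos 0 1 x one_ne_zero

theorem cdf_gaussianReal_mem_Ioo (y : ℝ) : cdf (gaussianReal 0 1) y ∈ Set.Ioo (0 : ℝ) 1 :=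
  ⟨(cdf_nonneg _ (y - 1)).trans_lt (strictMono_cdf_gaussianReal (by linarith)),
    (strictMono_cdf_gaussianReal (lt_add_one y)).trans_le (cdf_le_one _ _)⟩

theorem exists_cdf_gaussianReal_eq {p : ℝ} (hp : p ∈ Set.Ioo (0 : ℝ) 1) :
    ∃ y, cdf (gaussianReal 0 1) y = p := by
  have hc : Continuous (cdf (gaussianReal 0 1)) :=
    continuous_iff_continuousAt.2 fun x => (hasDerivAt_cdf_gaussianReal x).continuousAt
  obtain ⟨a, ha⟩ := ((tendsto_cdf_atBot (gaussianReal 0 1)).eventually_lt_const hp.1).exists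
  obtain ⟨b, hb⟩ := ((tendsto_cdf_atTop (gaussianReal 0 1)).eventually_const_lt hp.2).exists
  exact mem_range_of_exists_le_of_exists_ge hc ⟨a, ha.le⟩ ⟨b, hb.le⟩

theorem gaussianQuantile_cdf (y : ℝ) :
    gaussianQuantile (cdf (gaussianReal 0 1) y) = (y : EReal) := by
  refine IsLeast.csInf_eq ⟨⟨y, le_refl (cdf (gaussianReal 0 1) y), rfl⟩, ?_⟩
  rintro _ ⟨z, hz, rfl⟩
  exact EReal.coe_le_coe_iff.2 (strictMono_cdf_gaussianReal.le_iff_le.1 hz)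

theorem coe_toReal_gaussianQuantile {p : ℝ} (hp : p ∈ Set.Ioo (0 : ℝ) 1) :
    ((gaussianQuantile p).toReal : EReal) = gaussianQuantile p := by
  obtain ⟨y, rfl⟩ := exists_cdf_gaussianReal_eq hp
  simp [gaussianQuantile_cdf]

theorem cdf_toReal_gaussianQuantile {p : ℝ} (hp : p ∈ Set.Ioo (0 : ℝ) 1) :
    cdf (gaussianReal 0 1) (gaussianQuantile p).toReal = p := by
  obtain ⟨y, rfl⟩ := exists_cdf_gaussianReal_eq hp
  simp [gaussianQuantile_cdf]

theorem gaussianProfile_pos (p : ℝ) : 0 < gaussianProfile p :=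
  gaussianPDFReal_pos 0 1 _ one_ne_zero

theorem hasDerivAt_toReal_gaussianQuantile {p : ℝ} (hp : p ∈ Set.Ioo (0 : ℝ) 1) :
    HasDerivAt (fun p => (gaussianQuantile p).toReal) (gaussianProfile p)⁻¹ p := by
  have hnhds : Set.Ioo (0 : ℝ) 1 ∈ 𝓝 p := isOpen_Ioo.mem_nhds hp
  have hmono : MonotoneOn (fun p => (gaussianQuantile p).toReal) (Set.Ioo 0 1) := by
    intro a ha b hb hab
    rwa [← strictMono_cdf_gaussianReal.le_iff_le, cdf_toReal_gaussianQuantile ha,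
      cdf_toReal_gaussianQuantile hb]
  have himage : (fun p => (gaussianQuantile p).toReal) '' Set.Ioo 0 1 = Set.univ :=
    Set.eq_univ_of_forall fun y =>
      ⟨_, cdf_gaussianReal_mem_Ioo y, by simp [gaussianQuantile_cdf]⟩
  -- The inverse function rule needs continuity of the inverse, which follows from monotonicity and
  -- surjectivity onto `ℝ`.
  refine HasDerivAt.of_local_left_inverse
    (continuousAt_of_monotoneOn_of_image_mem_nhds hmono hnhds (by rw [himage]; exact univ_mem))
    (hasDerivAt_cdf_gaussianReal _) (gaussianProfile_pos p).ne' ?_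
  filter_upwards [hnhds] with a ha
  exact cdf_toReal_gaussianQuantile ha

/-- Bootstrap: the derivative is `1 / φ(Φ⁻¹(p))`, as regular as `Φ⁻¹` itself. -/
theorem contDiffOn_toReal_gaussianQuantile (n : ℕ) :
    ContDiffOn ℝ n (fun p => (gaussianQuantile p).toReal) (Set.Ioo 0 1) := by
  induction n with
  | zero =>
    exact contDiffOn_zero.2 fun p hp =>
      (hasDerivAt_toReal_gaussianQuantile hp).continuousAt.continuousWithinAt
  | succ n ih =>
    push_cast
    refine (contDiffOn_succ_iff_deriv_of_isOpen isOpen_Ioo).2 ⟨fun p hp =>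
      (hasDerivAt_toReal_gaussianQuantile hp).differentiableAt.differentiableWithinAt, by simp, ?_⟩
    have hpdf : ContDiff ℝ n (gaussianPDFReal 0 1) := by
      unfold gaussianPDFReal
      fun_prop
    exact ((hpdf.comp_contDiffOn ih).inv fun p _ => (gaussianProfile_pos p).ne').congr
      fun p hp => (hasDerivAt_toReal_gaussianQuantile hp).deriv

/-- Partial derivatives of a function composed with the coordinatewise Gaussian quantile. -/
theorem partialDeriv_comp_quantile {k : ℕ} {G : (Fin k → ℝ) → ℝ} {x : Fin k → ℝ}
    (hG : DifferentiableAt ℝ G fun i => (gaussianQuantile (x i)).toReal)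
    (hx : ∀ i, x i ∈ Set.Ioo (0 : ℝ) 1) (i : Fin k) :
    partialDeriv i (fun x => G fun i => (gaussianQuantile (x i)).toReal) x =
      fderiv ℝ G (fun i => (gaussianQuantile (x i)).toReal) (Pi.single i 1)
        / gaussianProfile (x i) := by
  have hcurve : HasDerivAt (fun (t : ℝ) (l : Fin k) =>
      (gaussianQuantile ((x + t • (Pi.single i 1 : Fin k → ℝ)) l)).toReal)
      ((gaussianProfile (x i))⁻¹ • Pi.single i 1) 0 := by
    refine hasDerivAt_pi.2 fun l => ?_
    have hline : HasDerivAt (fun t : ℝ => (x + t • (Pi.single i 1 : Fin k → ℝ)) l)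
        ((Pi.single i 1 : Fin k → ℝ) l) 0 := by
      simpa using ((hasDerivAt_id' (0 : ℝ)).mul_const
        ((Pi.single i 1 : Fin k → ℝ) l)).const_add (x l)
    have hq : HasDerivAt (fun p => (gaussianQuantile p).toReal) (gaussianProfile (x l))⁻¹
        ((x + (0 : ℝ) • (Pi.single i 1 : Fin k → ℝ)) l) := by
      simpa using hasDerivAt_toReal_gaussianQuantile (hx l)
    refine (hq.comp 0 hline).congr_deriv ?_
    by_cases h : l = i
    · subst h; simp
    · simp [h]
  have hG' : HasFDerivAt G (fderiv ℝ G fun i => (gaussianQuantile (x i)).toReal)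
      (fun l : Fin k => (gaussianQuantile ((x + (0 : ℝ) • (Pi.single i 1 : Fin k → ℝ)) l)).toReal) := by
    simpa using hG.hasFDerivAt
  have := (hG'.comp_hasDerivAt (0 : ℝ) hcurve).deriv
  rw [partialDeriv, lineDeriv]
  refine this.trans ?_
  rw [map_smul, smul_eq_mul]
  ring

end Quantile

/-! ### Laplacian-type matrices and the square root of `M` -/

section MatrixLemmas

variable {ι : Type*} [Fintype ι]

/-- A symmetric matrix with nonnegative off-diagonal entries and zero row sums is negative
semidefinite. -/
theorem posSemidef_neg_of_row_sum_eq_zero {A : Matrix ι ι ℝ} (hsymm : ∀ i j, A i j = A j i)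
    (hoff : ∀ i j, i ≠ j → 0 ≤ A i j) (hrow : ∀ i, ∑ j, A i j = 0) : (-A).PosSemidef := by
  refine PosSemidef.of_dotProduct_mulVec_nonneg ?_ fun x => ?_
  · ext i j
    simp [hsymm i j]
  · have h1 : ∑ i, ∑ j, A i j * x i ^ 2 = 0 := by simp [← Finset.sum_mul, hrow]
    have h2 : ∑ i, ∑ j, A i j * x j ^ 2 = 0 := by
      rw [Finset.sum_comm, ← h1]
      exact Finset.sum_congr rfl fun i _ => Finset.sum_congr rfl fun j _ => by rw [hsymm]
    -- The Dirichlet form of the Laplacian `-A`; diagonal entries of `A` drop out of it.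
    have h3 : star x ⬝ᵥ (-A) *ᵥ x = (∑ i, ∑ j, A i j * (x i - x j) ^ 2) / 2 := by
      have : ∑ i, ∑ j, A i j * (x i - x j) ^ 2 = ∑ i, ∑ j, A i j * x i ^ 2
          + ∑ i, ∑ j, A i j * x j ^ 2 - 2 * ∑ i, ∑ j, x i * (A i j * x j) := by
        simp only [Finset.mul_sum, ← Finset.sum_add_distrib, ← Finset.sum_sub_distrib]
        exact Finset.sum_congr rfl fun i _ => Finset.sum_congr rfl fun j _ => by ring
      rw [this, h1, h2, neg_mulVec, dotProduct_neg]
      simp only [dotProduct, mulVec, star_trivial, ← Finset.mul_sum]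
      ring
    rw [h3]
    refine div_nonneg (Finset.sum_nonneg fun i _ => Finset.sum_nonneg fun j _ => ?_) two_pos.le
    by_cases h : i = j
    · simp [h]
    · exact mul_nonneg (hoff i j h) (sq_nonneg _)

open scoped RealInnerProductSpace MatrixOrder

variable [DecidableEq ι]

/-- The rows of the square root of `M`. -/
noncomputable def sqrtRow (M : Matrix ι ι ℝ) (i : ι) : EuclideanSpace ℝ ι :=
  WithLp.toLp 2 (CFC.sqrt M i)

theorem inner_sqrtRow_left (M : Matrix ι ι ℝ) (i : ι) (z : EuclideanSpace ℝ ι) :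
    ⟪sqrtRow M i, z⟫ = toEuclideanCLM (𝕜 := ℝ) (CFC.sqrt M) z i := by
  simp [sqrtRow, PiLp.inner_apply, mulVec, dotProduct, mul_comm]

theorem inner_sqrtRow {M : Matrix ι ι ℝ} (hM : M.PosDef) (i j : ι) :
    ⟪sqrtRow M i, sqrtRow M j⟫ = M i j := by
  have hsa : (CFC.sqrt M).IsHermitian := (CFC.sqrt_nonneg M).isSelfAdjoint
  have hsq : CFC.sqrt M * CFC.sqrt M = M := CFC.sqrt_mul_sqrt_self M hM.posSemidef.nonneg
  conv_rhs => rw [← hsq, mul_apply]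
  rw [PiLp.inner_apply]
  refine Finset.sum_congr rfl fun l _ => ?_
  have := hsa.apply l j
  simp only [star_trivial] at this
  simp [sqrtRow, this, mul_comm]

/-- The Gram matrix of these rows is the positive definite `M`. -/
theorem linearIndepOn_sqrtRow {M : Matrix ι ι ℝ} (hM : M.PosDef) (s : Set ι) :
    LinearIndepOn ℝ (sqrtRow M) s := by
  refine LinearIndependent.linearIndepOn ?_ s
  rw [Fintype.linearIndependent_iff]
  intro f hf
  by_contra! hne
  have hf0 : f ≠ 0 := fun h => by simp [h] at hne
  have hpos := hM.dotProduct_mulVec_pos hf0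
  have : star f ⬝ᵥ M *ᵥ f = ⟪∑ i, f i • sqrtRow M i, ∑ i, f i • sqrtRow M i⟫ := by
    simp only [sum_inner, inner_sum, real_inner_smul_left, real_inner_smul_right,
      inner_sqrtRow hM, dotProduct, mulVec, Finset.mul_sum, star_trivial]
    rw [Finset.sum_comm]
    refine Finset.sum_congr rfl fun i _ => Finset.sum_congr rfl fun j _ => ?_
    ring
  rw [this, hf, inner_zero_left] at hpos
  exact hpos.false

end MatrixLemmas

/-! ### First and second derivatives of `J` -/

section Orthant

open Filter Topology
open scoped RealInnerProductSpace MatrixOrder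

variable {k : ℕ} {M : Matrix (Fin k) (Fin k) ℝ}

theorem isOpen_cube : IsOpen {x : Fin k → ℝ | ∀ i, x i ∈ Set.Ioo (0 : ℝ) 1} := by
  have : {x : Fin k → ℝ | ∀ i, x i ∈ Set.Ioo (0 : ℝ) 1}
      = Set.univ.pi fun _ => Set.Ioo (0 : ℝ) 1 := by
    ext
    simp
  rw [this]
  exact isOpen_set_pi Set.finite_univ fun _ _ => isOpen_Ioo

theorem gaussianOrthant_eq_orthantProb (M : Matrix (Fin k) (Fin k) ℝ) {x : Fin k → ℝ}
    (hx : ∀ i, x i ∈ Set.Ioo (0 : ℝ) 1) :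
    gaussianOrthant M x =
      orthantProb (sqrtRow M) Finset.univ fun i => (gaussianQuantile (x i)).toReal := by
  have hset : {y : EuclideanSpace ℝ (Fin k) | ∀ i, ((y i : ℝ) : EReal) ≤ gaussianQuantile (x i)}
      = {y | ∀ i, y i ≤ (gaussianQuantile (x i)).toReal} := by
    ext y
    refine forall_congr' fun i => ?_
    rw [← coe_toReal_gaussianQuantile (hx i), EReal.coe_le_coe_iff, EReal.toReal_coe]
  have hmeas : MeasurableSet {y : EuclideanSpace ℝ (Fin k) |
      ∀ i, y i ≤ (gaussianQuantile (x i)).toReal} := by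
    have : {y : EuclideanSpace ℝ (Fin k) | ∀ i, y i ≤ (gaussianQuantile (x i)).toReal}
        = ⋂ i, {y | y i ≤ (gaussianQuantile (x i)).toReal} := by
      ext
      simp
    rw [this]
    exact MeasurableSet.iInter fun i => measurableSet_le (by fun_prop) (by fun_prop)
  rw [gaussianOrthant, hset, multivariateGaussian, map_measureReal_apply (by fun_prop) hmeas,
    orthantProb]
  congr 1
  ext z
  simp [inner_sqrtRow_left]

theorem contDiffOn_gaussianOrthant (hM : M.PosDef) (n : ℕ) :
    ContDiffOn ℝ n (gaussianOrthant M) {x | ∀ i, x i ∈ Set.Ioo (0 : ℝ) 1} := by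
  refine ((contDiff_orthantProb n (linearIndepOn_sqrtRow hM _)).comp_contDiffOn
    (contDiffOn_pi.2 fun i => ?_)).congr fun x hx => gaussianOrthant_eq_orthantProb M hx
  exact (contDiffOn_toReal_gaussianQuantile n).comp (contDiff_apply ℝ ℝ i).contDiffOn
    fun x hx => hx i

/-- The threshold of the conditional orthant event given that the `j`-th coordinate is `b j`. -/
def shiftedThreshold (M : Matrix (Fin k) (Fin k) ℝ) (j : Fin k) (b : Fin k → ℝ) : Fin k → ℝ :=
  fun l => b l - M j l * b j

theorem norm_sqrtRow (hM : M.PosDef) (hdiag : ∀ i, M i i = 1) (i : Fin k) :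
    ‖sqrtRow M i‖ = 1 := by
  rw [← sq_eq_sq₀ (norm_nonneg _) zero_le_one, ← real_inner_self_eq_norm_sq, inner_sqrtRow hM,
    hdiag, one_pow]

/-- The first partial derivatives of `J` are conditional orthant probabilities. -/
theorem partialDeriv_gaussianOrthant (hM : M.PosDef) (hdiag : ∀ i, M i i = 1) {x : Fin k → ℝ}
    (hx : ∀ i, x i ∈ Set.Ioo (0 : ℝ) 1) (j : Fin k) :
    partialDeriv j (gaussianOrthant M) x =
      orthantProb (regressionResidual (sqrtRow M) j) (Finset.univ.erase j)
        (shiftedThreshold M j fun i => (gaussianQuantile (x i)).toReal) := by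
  have hli := linearIndepOn_sqrtRow hM ((Finset.univ : Finset (Fin k)) : Set (Fin k))
  have hev : gaussianOrthant M =ᶠ[𝓝 x] fun x => orthantProb (sqrtRow M) Finset.univ
      fun i => (gaussianQuantile (x i)).toReal := by
    filter_upwards [isOpen_cube.mem_nhds hx] with y hy
    exact gaussianOrthant_eq_orthantProb M hy
  rw [partialDeriv, hev.lineDeriv_eq, ← partialDeriv, partialDeriv_comp_quantile
    (hasFDerivAt_orthantProb hli _).differentiableAt hx, fderiv_orthantProb_single hli,
    div_eq_iff (gaussianProfile_pos _).ne', mul_comm]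
  simp only [orthantProbPartial, gaussianProfile, norm_sqrtRow hM hdiag, regressionCoeff,
    inner_sqrtRow hM, Finset.mem_univ, if_true, one_pow, Real.toNNReal_one, div_one]
  rfl

/-- The entries of the Hessian of `J`. -/
theorem hessianMatrix_gaussianOrthant (hM : M.PosDef) (hdiag : ∀ i, M i i = 1) {x : Fin k → ℝ}
    (hx : ∀ i, x i ∈ Set.Ioo (0 : ℝ) 1) (j : Fin k) :
    ∃ B : Fin k → ℝ, (∀ l, 0 ≤ B l) ∧ B j = 0 ∧ ∀ i,
      hessianMatrix (gaussianOrthant M) x i j =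
        (if i = j then -∑ l, M j l * B l else B i) / gaussianProfile (x i) := by
  set w := regressionResidual (sqrtRow M) j with hw
  have hli : LinearIndepOn ℝ w (Finset.univ.erase j : Finset (Fin k)) :=
    linearIndepOn_residual (linearIndepOn_sqrtRow hM _) (Finset.mem_univ j)
  set b : Fin k → ℝ := fun i => (gaussianQuantile (x i)).toReal with hb
  -- The coordinate `j` is conditioned on, so its threshold no longer matters.
  have hBj : orthantProbPartial w (Finset.univ.erase j) j (shiftedThreshold M j b) = 0 := by
    simp [orthantProbPartial]
  refine ⟨fun l => orthantProbPartial w (Finset.univ.erase j) l (shiftedThreshold M j b),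
    fun l => orthantProbPartial_nonneg _ _ _ _, hBj, fun i => ?_⟩
  have hev : partialDeriv j (gaussianOrthant M) =ᶠ[𝓝 x] fun x =>
      (fun b => orthantProb w (Finset.univ.erase j) (shiftedThreshold M j b))
        fun i => (gaussianQuantile (x i)).toReal := by
    filter_upwards [isOpen_cube.mem_nhds hx] with y hy
    exact partialDeriv_gaussianOrthant hM hdiag hy j
  -- The threshold shift is linear: it fixes `e_i` for `i ≠ j` and sends `e_j` to `e_j - ∑ l, M j l
  -- • e_l`, whence the two cases of the formula.
  let S : (Fin k → ℝ) →L[ℝ] (Fin k → ℝ) := ContinuousLinearMap.pi fun l =>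
    ContinuousLinearMap.proj l - M j l • ContinuousLinearMap.proj j
  have hS : (shiftedThreshold M j : (Fin k → ℝ) → Fin k → ℝ) = S := by
    ext b l
    simp [S, shiftedThreshold]
  have hK : HasFDerivAt (fun b => orthantProb w (Finset.univ.erase j) (shiftedThreshold M j b)) _ b :=
    (hasFDerivAt_orthantProb hli _).comp b (hS ▸ S.hasFDerivAt)
  rw [hessianMatrix, of_apply, partialDeriv, hev.lineDeriv_eq, ← partialDeriv,
    partialDeriv_comp_quantile hK.differentiableAt hx, hK.fderiv]
  congr 1
  by_cases hij : i = j
  · subst hij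
    simp [S, sub_mul, Finset.sum_sub_distrib, Pi.single_apply, hBj, mul_comm]
  · simp [S, Pi.single_apply, hij, Ne.symm hij]

/-- The explicit entries are computed column by column and are not visibly symmetric; this turns
column sums into row sums. -/
theorem hessianMatrix_symm {f : (Fin k → ℝ) → ℝ} {x : Fin k → ℝ} (hf : ContDiffAt ℝ 2 f x)
    (i j : Fin k) : hessianMatrix f x i j = hessianMatrix f x j i := by
  have h : ∀ i j, hessianMatrix f x i j
      = fderiv ℝ (fderiv ℝ f) x (Pi.single i 1) (Pi.single j 1) := by
    intro i j
    have hev : partialDeriv j f =ᶠ[𝓝 x] fun y => fderiv ℝ f y (Pi.single j 1) := by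
      filter_upwards [hf.eventually (by simp)] with y hy
      exact (hy.differentiableAt (by simp)).lineDeriv_eq_fderiv
    have hd : DifferentiableAt ℝ (fderiv ℝ f) x :=
      (hf.fderiv_right (m := 1) (by norm_num)).differentiableAt (by simp)
    rw [hessianMatrix, of_apply, partialDeriv, hev.lineDeriv_eq,
      (hd.clm_apply (differentiableAt_const _)).lineDeriv_eq_fderiv,
      fderiv_clm_apply hd (differentiableAt_const _)]
    simp
  rw [h, h]
  exact hf.isSymmSndFDerivAt (by simp) _ _

end Orthant

theorem proposition7 {k : ℕ} (M : Matrix (Fin k) (Fin k) ℝ) (hM : M.PosDef)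
    (hdiag : ∀ i, M i i = 1) (hnonneg : ∀ i j, 0 ≤ M i j) :
    ContDiffOn ℝ 2 (gaussianOrthant M) {x | ∀ i, x i ∈ Set.Ioo (0 : ℝ) 1} ∧
    ∀ x : Fin k → ℝ, (∀ i, x i ∈ Set.Ioo (0 : ℝ) 1) →
      (-(M ⊙ hessianMatrix (gaussianOrthant M) x)).PosSemidef ∧
      ∃ A : Matrix (Fin k) (Fin k) ℝ,
        (∀ i j, i ≠ j → 0 ≤ A i j) ∧ (∀ i, ∑ j, A i j = 0) ∧
        M ⊙ hessianMatrix (gaussianOrthant M) x =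
          diagonal (fun i => 1 / gaussianProfile (x i)) * A *
            diagonal (fun i => 1 / gaussianProfile (x i)) := by
  have hC : ContDiffOn ℝ 2 (gaussianOrthant M) {x | ∀ i, x i ∈ Set.Ioo (0 : ℝ) 1} := by
    exact_mod_cast contDiffOn_gaussianOrthant hM 2
  refine ⟨hC, fun x hx => ?_⟩
  have hHs : ∀ i j, hessianMatrix (gaussianOrthant M) x i j =
      hessianMatrix (gaussianOrthant M) x j i :=
    hessianMatrix_symm (hC.contDiffAt (isOpen_cube.mem_nhds hx))
  have hMs : ∀ i j, M i j = M j i := fun i j => by simpa using (hM.isHermitian.apply i j).symm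
  choose B hB0 hBd hB using hessianMatrix_gaussianOrthant hM hdiag hx
  set H := hessianMatrix (gaussianOrthant M) x
  have hI : ∀ i, 0 < gaussianProfile (x i) := fun i => gaussianProfile_pos _
  set A : Matrix (Fin k) (Fin k) ℝ :=
    of fun i j => gaussianProfile (x i) * (M i j * H i j) * gaussianProfile (x j) with hA
  have hAs : ∀ i j, A i j = A j i := fun i j => by
    simp only [hA, of_apply]
    rw [hHs i j, hMs i j]
    ring
  have hoff : ∀ i j, i ≠ j → 0 ≤ A i j := fun i j hij => by
    have : 0 ≤ H i j := by
      rw [hB j i, if_neg hij]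
      exact div_nonneg (hB0 j i) (hI i).le
    exact mul_nonneg (mul_nonneg (hI i).le (mul_nonneg (hnonneg i j) this)) (hI j).le
  have hrow : ∀ i, ∑ j, A i j = 0 := fun i => by
    have hterm : ∀ j, A j i = gaussianProfile (x i) *
        (M j i * if j = i then -∑ l, M i l * B i l else B i j) := fun j => by
      simp only [hA, of_apply]
      rw [hB i j]
      field_simp [(hI j).ne']
    -- The diagonal term, with `M i i = 1` and `B i i = 0`, cancels the sum of the off-diagonal
    -- ones.
    rw [Finset.sum_congr rfl fun j _ => (hAs i j).trans (hterm j), ← Finset.mul_sum,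
      ← Finset.add_sum_erase _ _ (Finset.mem_univ i), if_pos rfl, hdiag,
      ← Finset.add_sum_erase _ (fun l => M i l * B i l) (Finset.mem_univ i), hBd,
      mul_zero, zero_add, one_mul]
    have : ∑ j ∈ Finset.univ.erase i, (M j i * if j = i then
        -∑ l ∈ Finset.univ.erase i, M i l * B i l else B i j) =
        ∑ j ∈ Finset.univ.erase i, M i j * B i j :=
      Finset.sum_congr rfl fun j hj => by rw [if_neg (Finset.ne_of_mem_erase hj), hMs j i]
    rw [this, neg_add_cancel, mul_zero]
  have hfac : M ⊙ H = diagonal (fun i => 1 / gaussianProfile (x i)) * A *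
      diagonal (fun i => 1 / gaussianProfile (x i)) := by
    ext i j
    have hi := (hI i).ne'
    have hj := (hI j).ne'
    simp only [hadamard_apply, mul_diagonal, diagonal_mul, hA, of_apply]
    field_simp
  refine ⟨?_, A, hoff, hrow, hfac⟩
  -- Congruence by a diagonal matrix preserves semidefiniteness.
  have hps := (posSemidef_neg_of_row_sum_eq_zero hAs hoff hrow).conjTranspose_mul_mul_same
    (diagonal fun i => 1 / gaussianProfile (x i))
  rw [hfac]
  simpa [diagonal_conjTranspose] using hps
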